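/- Let $E$ be a complex Banach lattice, i.e. the complexification $E = X \oplus iX$ of a real Banach lattice $X$, with modulus $|x+iy| = \sup_{\theta\in\mathbb{R}} (x\cos\theta + y\sin\theta)$ and norm $\|z\| = \|\,|z|\,\|$. Let $T$ be a bounded linear operator on $E$ which is positive, i.e. $T$ maps $E_+ = \{x \in X : x \ge 0\}$ into itself, and suppose that its spectral radius is $r(T) = 1$. For $\mu \in \mathbb{C}\setminus\sigma(T)$ let $R(\mu,T) = (\mu - T)^{-1}$, and let $\sigma_{\mathrm{per}}(T) = \{\mu \in \sigma(T) : |\mu| = r(T)\}$ be the peripheral spectrum of $T$. Let $\lambda \in \sigma_{\mathrm{per}}(T)$. Suppose that there is a decreasing sequence $(r_n)$ of real numbers $r_n > 1$ with $r_n \to 1$ such that, as $n \to \infty$, $$\|R(r_n\lambda,T)\| \sim \frac{1}{r_n-1} \qquad\text{and}\qquad \|R(r_n,T)\| = O\!\left(\frac{1}{(r_n-1)^2}\right),$$ where $a_n \sim b_n$ means that $a_n = O(b_n)$ and $b_n = O(a_n)$. Then $\lambda^k \in \sigma_{\mathrm{per}}(T)$ for all $k \in \mathbb{Z}$. -/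

import Mathlib

open Filter Topology Asymptotics
open scoped ENNReal

section Modulus

variable {X : Type*} [NormedAddCommGroup X] [NormedSpace ℝ X] [CompleteSpace X]
  [Lattice X] [IsOrderedAddMonoid X] [IsOrderedModule ℝ X] [HasSolidNorm X]

/-- `cos θ • x + sin θ • y`, the real part of `exp (-iθ) (x + i y)`. -/
noncomputable def rotatedRe (x y : X) (θ : ℝ) : X := Real.cos θ • x + Real.sin θ • y

/-- In a real Banach lattice, `sup_θ (cos θ • x + sin θ • y)` exists. -/
theorem exists_isLUB_rotatedRe (x y : X) : ∃ m : X, IsLUB (Set.range (rotatedRe x y)) m := by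
  have hsm : ∀ (a b : ℝ) (z : X), |a| ≤ b → a • z ≤ b • |z| := fun a b z h => by
    have hb : 0 ≤ b := (abs_nonneg a).trans h
    rcases le_total 0 a with ha | ha
    · rw [abs_of_nonneg ha] at h
      exact (smul_le_smul_of_nonneg_left (le_abs_self z) ha).trans
        (smul_le_smul_of_nonneg_right h (abs_nonneg z))
    · rw [abs_of_nonpos ha] at h
      rw [← neg_smul_neg]
      exact (smul_le_smul_of_nonneg_left (neg_le_abs z) (neg_nonneg.2 ha)).trans
        (smul_le_smul_of_nonneg_right h (abs_nonneg z))
  set c : X := |x| + |y| with hc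
  have hc0 : 0 ≤ c := add_nonneg (abs_nonneg x) (abs_nonneg y)
  have hlip : ∀ (θ φ ε : ℝ), |θ - φ| ≤ ε → rotatedRe x y θ ≤ rotatedRe x y φ + ε • c := by
    intro θ φ ε h
    have h1 := hsm (Real.cos θ - Real.cos φ) ε x ((Real.abs_cos_sub_cos_le θ φ).trans h)
    have h2 := hsm (Real.sin θ - Real.sin φ) ε y ((Real.abs_sin_sub_sin_le θ φ).trans h)
    have h3 := add_le_add_left (add_le_add h1 h2) (rotatedRe x y φ)
    calc rotatedRe x y θ = (Real.cos θ - Real.cos φ) • x + (Real.sin θ - Real.sin φ) • y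
          + rotatedRe x y φ := by unfold rotatedRe; module
      _ ≤ ε • |x| + ε • |y| + rotatedRe x y φ := h3
      _ = _ := by rw [hc]; module
  let ε : ℕ → ℝ := fun n => 1 / ((n : ℝ) + 1)
  let s : ℕ → X := fun n => (Finset.range (7 * (n + 1) + 1)).sup' ⟨0, by simp⟩
    (fun k => rotatedRe x y (k * ε n))
  have hε : Tendsto ε atTop (𝓝 0) := tendsto_one_div_add_atTop_nhds_zero_nat
  have hεp : ∀ n, 0 < ε n := fun n => by positivity
  have hper : Function.Periodic (rotatedRe x y) (2 * Real.pi) := fun θ => by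
    simp [rotatedRe]
  have hub : ∀ n θ, rotatedRe x y θ ≤ s n + ε n • c := by
    intro n θ
    obtain ⟨φ, ⟨h0, h1⟩, hφ⟩ := hper.exists_mem_Ico₀ Real.two_pi_pos θ
    rw [hφ]
    have hn : (0 : ℝ) < (n : ℝ) + 1 := by positivity
    have hk0 : 0 ≤ ((n : ℝ) + 1) * φ := by positivity
    have hk1 := Nat.floor_le hk0
    have hk2 := Nat.lt_floor_add_one (((n : ℝ) + 1) * φ)
    set k := ⌊((n : ℝ) + 1) * φ⌋₊ with hk
    have hmem : k ∈ Finset.range (7 * (n + 1) + 1) := by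
      have : (k : ℝ) < ((7 * (n + 1) + 1 : ℕ) : ℝ) := by
        push_cast
        nlinarith [Real.pi_lt_d2]
      exact Finset.mem_range.2 (by exact_mod_cast this)
    refine (hlip φ (k * ε n) (ε n) ?_).trans (add_le_add_left
      (Finset.le_sup' (fun k : ℕ => rotatedRe x y (k * ε n)) hmem) _)
    have e1 : φ - k * ε n = (((n : ℝ) + 1) * φ - k) * ε n := by
      simp only [ε]; field_simp
    rw [e1, abs_mul, abs_of_pos (hεp n), abs_of_nonneg (by linarith)]
    nlinarith [hεp n]
  have hle : ∀ n u, (∀ θ, rotatedRe x y θ ≤ u) → s n ≤ u := fun n u h =>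
    Finset.sup'_le _ _ fun k _ => h _
  have hdist : ∀ n m, n ≤ m → dist (s n) (s m) ≤ ε n * ‖c‖ := by
    intro n m hnm
    have hmn : ε m ≤ ε n := by
      simp only [ε]
      gcongr
    have h1 : s m ≤ s n + ε n • c := hle _ _ (hub n)
    have h2 : s n ≤ s m + ε n • c := (hle _ _ (hub m)).trans
      (add_le_add_right (smul_le_smul_of_nonneg_right hmn hc0) _)
    have h3 : |s n - s m| ≤ |ε n • c| := by
      rw [abs_of_nonneg (smul_nonneg (hεp n).le hc0)]
      refine abs_le'.2 ⟨sub_le_iff_le_add'.2 h2, ?_⟩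
      rw [neg_sub]
      exact sub_le_iff_le_add'.2 h1
    rw [dist_eq_norm]
    refine (norm_le_norm_of_abs_le_abs h3).trans ?_
    rw [norm_smul, Real.norm_of_nonneg (hεp n).le]
  have hcau : CauchySeq s := by
    refine cauchySeq_of_le_tendsto_0' (fun n => ε n * ‖c‖) hdist ?_
    simpa using hε.mul_const ‖c‖
  obtain ⟨m, hm⟩ := cauchySeq_tendsto_of_complete hcau
  refine ⟨m, ?_, ?_⟩
  · rintro _ ⟨θ, rfl⟩
    have : Tendsto (fun n => s n + ε n • c) atTop (𝓝 (m + (0 : ℝ) • c)) :=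
      hm.add (hε.smul_const c)
    rw [zero_smul, add_zero] at this
    exact ge_of_tendsto' this fun n => hub n θ
  · intro u hu
    exact le_of_tendsto' hm fun n => hle n u fun θ => hu ⟨θ, rfl⟩

/-- The modulus `|x + i y| = sup_θ (cos θ • x + sin θ • y)` of an element of the complexification
of a real Banach lattice. -/
noncomputable def complexModulus (x y : X) : X := (exists_isLUB_rotatedRe x y).choose

theorem isLUB_complexModulus (x y : X) :
    IsLUB (Set.range fun θ : ℝ => Real.cos θ • x + Real.sin θ • y) (complexModulus x y) :=
  (exists_isLUB_rotatedRe x y).choose_spec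

end Modulus

/-- The structure of a complex Banach lattice with real part `X` on the complex Banach space `E`:
`X` is a real Banach lattice, `E = X ⊕ i X` is its complexification, and the norm of
`E` is `‖z‖ = ‖ |z| ‖`, where `|z|` is the modulus of `z`. -/
structure ComplexBanachLattice (X E : Type*)
    [NormedAddCommGroup X] [NormedSpace ℝ X] [CompleteSpace X]
    [Lattice X] [IsOrderedAddMonoid X] [IsOrderedModule ℝ X] [HasSolidNorm X]
    [NormedAddCommGroup E] [NormedSpace ℂ E] [CompleteSpace E] where
  /-- The embedding of the real part. -/
  ofReal : X →ₗ[ℝ] E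
  bijective_re_im :
    Function.Bijective fun p : X × X => ofReal p.1 + Complex.I • ofReal p.2
  norm_eq_norm_modulus (x y : X) :
    ‖ofReal x + Complex.I • ofReal y‖ = ‖complexModulus x y‖

namespace ComplexBanachLattice

variable {X E : Type*}
  [NormedAddCommGroup X] [NormedSpace ℝ X] [CompleteSpace X]
  [Lattice X] [IsOrderedAddMonoid X] [IsOrderedModule ℝ X] [HasSolidNorm X]
  [NormedAddCommGroup E] [NormedSpace ℂ E] [CompleteSpace E]

/-- The positive cone `E₊`: the positive elements of the real part. -/
def positiveCone (L : ComplexBanachLattice X E) : Set E := L.ofReal '' {x : X | 0 ≤ x}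

/-- A bounded operator is positive if it maps the positive cone into itself. -/
def IsPositiveOperator (L : ComplexBanachLattice X E) (T : E →L[ℂ] E) : Prop :=
  Set.MapsTo T L.positiveCone L.positiveCone

end ComplexBanachLattice

/-- The peripheral spectrum: the spectral values whose modulus is the spectral radius. -/
def peripheralSpectrum {E : Type*} [NormedAddCommGroup E] [NormedSpace ℂ E]
    (T : E →L[ℂ] E) : Set ℂ :=
  {μ : ℂ | μ ∈ spectrum ℂ T ∧ (‖μ‖₊ : ℝ≥0∞) = spectralRadius ℂ T}

/-!
Let `μ = lam ^ k` and suppose that `μ` is not in the spectrum. Take an approximate eigenvector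
`y`, so that `e = T y - lam y` is as small as required, and let `v = |y| sgn(y) ^ k`.

*Powers of the sign.* For large `C` the positively homogeneous functions
`C |a| |ζ| - Re (a |ζ| sgn(ζ) ^ k)` on `ℂ` are sublinear, i.e. suprema of real linear functionals.
Such suprema exist in a Banach lattice, which defines `v` (`signPow`) without a representation
of the lattice by functions, and identities between them reduce to comparing linear functionals with
multiples of the modulus. As a positive operator raises suprema, it satisfies
`|T v(z) - v(T z)| ≤ C (T|z| - |T z|)` (`modulus_apply_signPow_sub_le`). Hence `w = T v - μ v`
satisfies `|w| ≤ C (T|y| - |y|) + (3 C + 1) |e|`.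

*Resolvents.* Let `P = R(r, T)` and `Q = R(s, T)` with `1 < r < s`. Then `v = -R(μ, T) w`, and the
resolvent equation, used twice, together with `|R(s μ, T) u| ≤ Q|u|` bounds `|v|` by
`Q|w| + (s - 1) Q²|w| + (s - 1)² |f|`, where `f = R(s μ, T)² R(μ, T) w`. Apply `P`. Since
`P Q ≤ P / (s - r)` and `P (T - 1) ≤ (r - 1) P`, and `|y| ≤ |v|`, the terms with `w` are at most
`P|y| / 2`, up to a multiple of `P|e|`, as soon as `s - 1` is a large multiple of `r - 1`. What
remains is `P|y| ≤ 2 (s - 1)² P|f|` up to `e`, and `|y| ≤ (r - 1) P|y| + P|e|`, so that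
`‖y‖ ≤ 2 (r - 1) (s - 1)² ‖P‖ ‖f‖` up to `e` (`norm_le_of_approx_eigenvector`). The resolvents at
`μ` and `s μ` are bounded and `‖P‖ = O((r - 1)⁻²)`, so the right-hand side is `O(r - 1) ‖y‖`, which
is a contradiction for `r` close to `1`.
-/

/-! ### Real parts, moduli and positive operators -/

theorem norm_le_norm_of_nonneg_of_le {X : Type*} [NormedAddCommGroup X] [Lattice X]
    [IsOrderedAddMonoid X] [HasSolidNorm X] {x y : X} (hx : 0 ≤ x) (hxy : x ≤ y) : ‖x‖ ≤ ‖y‖ :=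
  norm_le_norm_of_abs_le_abs (by rwa [abs_of_nonneg hx, abs_of_nonneg (hx.trans hxy)])

namespace ComplexBanachLattice

variable {X E : Type*}
  [NormedAddCommGroup X] [NormedSpace ℝ X] [CompleteSpace X]
  [Lattice X] [IsOrderedAddMonoid X] [IsOrderedModule ℝ X] [HasSolidNorm X]
  [NormedAddCommGroup E] [NormedSpace ℂ E] [CompleteSpace E]
  (L : ComplexBanachLattice X E)

/-- The identification `(x, y) ↦ x + i y` of `X × X` with `E`, as a real linear equivalence. -/
noncomputable def prodEquiv : (X × X) ≃ₗ[ℝ] E :=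
  LinearEquiv.ofBijective
    (L.ofReal ∘ₗ LinearMap.fst ℝ X X + (Complex.I • L.ofReal) ∘ₗ LinearMap.snd ℝ X X)
    L.bijective_re_im

theorem prodEquiv_apply (p : X × X) :
    L.prodEquiv p = L.ofReal p.1 + Complex.I • L.ofReal p.2 := rfl

/-- The real part `E → X`, as a real linear map. -/
noncomputable def re : E →ₗ[ℝ] X := LinearMap.fst ℝ X X ∘ₗ L.prodEquiv.symm.toLinearMap

/-- The imaginary part `E → X`, as a real linear map. -/
noncomputable def im : E →ₗ[ℝ] X := LinearMap.snd ℝ X X ∘ₗ L.prodEquiv.symm.toLinearMap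

theorem re_add_im (z : E) : L.ofReal (L.re z) + Complex.I • L.ofReal (L.im z) = z :=
  L.prodEquiv.apply_symm_apply z

theorem re_im_mk (x y : X) :
    L.re (L.ofReal x + Complex.I • L.ofReal y) = x ∧
      L.im (L.ofReal x + Complex.I • L.ofReal y) = y := by
  have h := L.prodEquiv.symm_apply_apply (x, y)
  rw [prodEquiv_apply] at h
  exact ⟨congrArg Prod.fst h, congrArg Prod.snd h⟩

@[simp] theorem re_ofReal (x : X) : L.re (L.ofReal x) = x := by
  simpa using (L.re_im_mk x 0).1

@[simp] theorem im_ofReal (x : X) : L.im (L.ofReal x) = 0 := by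
  simpa using (L.re_im_mk x 0).2

theorem re_smul (a : ℂ) (z : E) : L.re (a • z) = a.re • L.re z - a.im • L.im z := by
  have h : a • z = L.ofReal (a.re • L.re z - a.im • L.im z) +
      Complex.I • L.ofReal (a.re • L.im z + a.im • L.re z) := by
    conv_lhs => rw [← L.re_add_im z, ← Complex.re_add_im a]
    simp only [map_sub, map_add, map_smul, ← Complex.coe_smul]
    have hI : Complex.I * Complex.I = -1 := Complex.I_mul_I
    match_scalars
    · ring
    · linear_combination (a.im : ℂ) * hI
  rw [h, (L.re_im_mk _ _).1]

theorem im_eq_re (z : E) : L.im z = L.re (-Complex.I • z) := by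
  rw [re_smul]; simp

/-- The elements of `E` are determined by the real parts of their complex multiples. -/
theorem ext_re {z w : E} (h : ∀ a : ℂ, L.re (a • z) = L.re (a • w)) : z = w := by
  rw [← L.re_add_im z, ← L.re_add_im w, im_eq_re, im_eq_re, h]
  have := h 1
  rw [one_smul, one_smul] at this
  rw [this]

/-- The modulus `|z| ∈ X` of `z ∈ E`. -/
noncomputable def modulus (z : E) : X := complexModulus (L.re z) (L.im z)

theorem norm_modulus (z : E) : ‖L.modulus z‖ = ‖z‖ := by
  rw [modulus, ← L.norm_eq_norm_modulus, re_add_im]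

theorem re_smul_le (a : ℂ) (z : E) : L.re (a • z) ≤ ‖a‖ • L.modulus z := by
  have h := (isLUB_complexModulus (L.re z) (L.im z)).1 ⟨-a.arg, rfl⟩
  have e : L.re (a • z) =
      ‖a‖ • (Real.cos (-a.arg) • L.re z + Real.sin (-a.arg) • L.im z) := by
    rw [re_smul, smul_add, smul_smul, smul_smul, Real.cos_neg, Real.sin_neg, mul_neg, neg_smul,
      Complex.norm_mul_cos_arg, Complex.norm_mul_sin_arg, sub_eq_add_neg]
  rw [e]
  exact smul_le_smul_of_nonneg_left h (norm_nonneg a)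

theorem modulus_le {z : E} {x : X} (h : ∀ a : ℂ, ‖a‖ = 1 → L.re (a • z) ≤ x) :
    L.modulus z ≤ x := by
  refine (isLUB_complexModulus (L.re z) (L.im z)).2 ?_
  rintro _ ⟨θ, rfl⟩
  have := h (Complex.exp ((-θ : ℝ) * Complex.I)) (Complex.norm_exp_ofReal_mul_I _)
  rw [re_smul, Complex.exp_ofReal_mul_I_re, Complex.exp_ofReal_mul_I_im] at this
  simpa using this

theorem re_le_modulus (z : E) : L.re z ≤ L.modulus z := by
  simpa using L.re_smul_le 1 z

theorem abs_re_le_modulus (z : E) : |L.re z| ≤ L.modulus z := by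
  refine abs_le'.2 ⟨L.re_le_modulus z, ?_⟩
  simpa using L.re_smul_le (-1) z

theorem modulus_nonneg (z : E) : 0 ≤ L.modulus z :=
  (abs_nonneg _).trans (L.abs_re_le_modulus z)

theorem modulus_add_le (z w : E) : L.modulus (z + w) ≤ L.modulus z + L.modulus w := by
  refine L.modulus_le fun a ha => ?_
  rw [smul_add, map_add]
  have h1 := L.re_smul_le a z
  have h2 := L.re_smul_le a w
  rw [ha, one_smul] at h1 h2
  exact add_le_add h1 h2

theorem modulus_smul_le (b : ℂ) (z : E) : L.modulus (b • z) ≤ ‖b‖ • L.modulus z := by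
  refine L.modulus_le fun a ha => ?_
  have h := L.re_smul_le (a * b) z
  rwa [norm_mul, ha, one_mul, mul_smul] at h

theorem modulus_neg (z : E) : L.modulus (-z) = L.modulus z := by
  refine le_antisymm ?_ ?_
  · simpa using L.modulus_smul_le (-1) z
  · simpa using L.modulus_smul_le (-1) (-z)

theorem modulus_smul_of_norm_eq_one {b : ℂ} (hb : ‖b‖ = 1) (z : E) :
    L.modulus (b • z) = L.modulus z := by
  have hb0 : b ≠ 0 := fun h => by simp [h] at hb
  refine le_antisymm ?_ ?_
  · simpa [hb] using L.modulus_smul_le b z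
  · simpa [hb, smul_smul, hb0] using L.modulus_smul_le b⁻¹ (b • z)

theorem modulus_ofReal {x : X} (hx : 0 ≤ x) : L.modulus (L.ofReal x) = x := by
  refine le_antisymm (L.modulus_le fun a ha => ?_) (by simpa using L.re_le_modulus (L.ofReal x))
  have h1 : a.re ≤ 1 := ha ▸ Complex.re_le_norm a
  rw [re_smul, re_ofReal, im_ofReal, smul_zero, sub_zero]
  simpa using smul_le_smul_of_nonneg_right h1 hx

theorem norm_ofReal {x : X} (hx : 0 ≤ x) : ‖L.ofReal x‖ = ‖x‖ := by
  rw [← L.norm_modulus (L.ofReal x), L.modulus_ofReal hx]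

theorem norm_re_le (z : E) : ‖L.re z‖ ≤ ‖z‖ := by
  rw [← norm_modulus L z]
  refine norm_le_norm_of_abs_le_abs ?_
  rw [abs_of_nonneg (L.modulus_nonneg z)]
  exact L.abs_re_le_modulus z

/-- The real part as a continuous real linear map. -/
noncomputable def reCLM : E →L[ℝ] X :=
  L.re.mkContinuous 1 fun z => by simpa using L.norm_re_le z

@[simp] theorem reCLM_apply (z : E) : L.reCLM z = L.re z := rfl

theorem mem_positiveCone_iff {z : E} : z ∈ L.positiveCone ↔ L.im z = 0 ∧ 0 ≤ L.re z := by
  constructor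
  · rintro ⟨x, hx, rfl⟩
    simpa using hx
  · rintro ⟨h1, h2⟩
    refine ⟨L.re z, h2, ?_⟩
    conv_rhs => rw [← L.re_add_im z, h1]
    simp

theorem isClosed_positiveCone : IsClosed L.positiveCone := by
  have hre : Continuous L.re := L.reCLM.continuous
  have him : Continuous L.im := by
    have : (L.im : E → X) = fun z => L.re (-Complex.I • z) := funext L.im_eq_re
    rw [this]
    exact hre.comp (continuous_const_smul _)
  have : L.positiveCone = {z | L.im z = 0} ∩ {z | 0 ≤ L.re z} := by
    ext z
    exact L.mem_positiveCone_iff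
  rw [this]
  exact (isClosed_eq him continuous_const).inter (isClosed_le continuous_const hre)

/-- The operator on `X` which a bounded operator `S` on `E` induces on real parts. It is the
restriction of `S` to `X` as soon as `S` leaves `X` invariant, in particular for positive `S`. -/
noncomputable def realOp (S : E →L[ℂ] E) : X →ₗ[ℝ] X :=
  L.re ∘ₗ (S.restrictScalars ℝ : E →ₗ[ℝ] E) ∘ₗ L.ofReal

theorem realOp_apply (S : E →L[ℂ] E) (x : X) : L.realOp S x = L.re (S (L.ofReal x)) := rfl

theorem norm_realOp_le (S : E →L[ℂ] E) {x : X} (hx : 0 ≤ x) : ‖L.realOp S x‖ ≤ ‖S‖ * ‖x‖ := by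
  rw [realOp_apply, ← L.norm_ofReal hx]
  exact (L.norm_re_le _).trans (S.le_opNorm _)

namespace IsPositiveOperator

variable {L} {S S' : E →L[ℂ] E}

theorem realOp_nonneg (hS : L.IsPositiveOperator S) {x : X} (hx : 0 ≤ x) :
    0 ≤ L.realOp S x :=
  (L.mem_positiveCone_iff.1 (hS ⟨x, hx, rfl⟩)).2

theorem realOp_mono (hS : L.IsPositiveOperator S) {x y : X} (hxy : x ≤ y) :
    L.realOp S x ≤ L.realOp S y := by
  have := hS.realOp_nonneg (sub_nonneg.2 hxy)
  rwa [map_sub, sub_nonneg] at this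

theorem ofReal_realOp (hS : L.IsPositiveOperator S) (x : X) :
    L.ofReal (L.realOp S x) = S (L.ofReal x) := by
  have key : ∀ y : X, 0 ≤ y → L.ofReal (L.realOp S y) = S (L.ofReal y) := by
    intro y hy
    obtain ⟨v, -, hv⟩ := hS ⟨y, hy, rfl⟩
    rw [realOp_apply, ← hv, re_ofReal]
  rw [← posPart_sub_negPart x, map_sub, map_sub, map_sub, map_sub, key _ (posPart_nonneg x),
    key _ (negPart_nonneg x)]

theorem re_apply (hS : L.IsPositiveOperator S) (z : E) : L.re (S z) = L.realOp S (L.re z) := by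
  conv_lhs => rw [← L.re_add_im z]
  rw [map_add, map_smul, ← hS.ofReal_realOp, ← hS.ofReal_realOp, (L.re_im_mk _ _).1]

theorem modulus_apply_le (hS : L.IsPositiveOperator S) (z : E) :
    L.modulus (S z) ≤ L.realOp S (L.modulus z) := by
  refine L.modulus_le fun a ha => ?_
  rw [← map_smul, hS.re_apply]
  refine hS.realOp_mono ?_
  simpa [ha] using L.re_smul_le a z

theorem realOp_mul (hS : L.IsPositiveOperator S) (S' : E →L[ℂ] E) (x : X) :
    L.realOp (S' * S) x = L.realOp S' (L.realOp S x) := by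
  rw [realOp_apply, realOp_apply L S', hS.ofReal_realOp]
  rfl

protected theorem one : L.IsPositiveOperator 1 := fun _ h => h

protected theorem mul (hS : L.IsPositiveOperator S) (hS' : L.IsPositiveOperator S') :
    L.IsPositiveOperator (S * S') := fun _ h => hS (hS' h)

protected theorem pow (hS : L.IsPositiveOperator S) (n : ℕ) : L.IsPositiveOperator (S ^ n) := by
  induction n with
  | zero => rw [pow_zero]; exact .one
  | succ n ih => rw [pow_succ]; exact ih.mul hS

end IsPositiveOperator

end ComplexBanachLattice

/-! ### Suprema of linear functionals, and powers on the unit circle -/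

namespace ComplexBanachLattice

variable {X E : Type*}
  [NormedAddCommGroup X] [NormedSpace ℝ X] [CompleteSpace X]
  [Lattice X] [IsOrderedAddMonoid X] [IsOrderedModule ℝ X] [HasSolidNorm X]
  [NormedAddCommGroup E] [NormedSpace ℂ E] [CompleteSpace E]
  (L : ComplexBanachLattice X E)

/-- In a complex Banach lattice, every bounded family of real linear functionals `z ↦ Re (m z)`
of `ℂ` has a supremum when it is evaluated at an element of `E`. -/
theorem exists_isLUB_re_smul {A : Set ℂ} (hA : Bornology.IsBounded A) (hne : A.Nonempty) (z : E) :
    ∃ x : X, IsLUB ((fun m : ℂ => L.re (m • z)) '' A) x := by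
  have hdiff : ∀ (m m' : ℂ) (ε : ℝ), ‖m - m'‖ ≤ ε →
      L.re (m • z) ≤ L.re (m' • z) + ε • L.modulus z := by
    intro m m' ε h
    have h1 := (L.re_smul_le (m - m') z).trans
      (smul_le_smul_of_nonneg_right h (L.modulus_nonneg z))
    rwa [sub_smul, map_sub, sub_le_iff_le_add'] at h1
  let ε : ℕ → ℝ := fun n => 1 / ((n : ℝ) + 1)
  have hε : Tendsto ε atTop (𝓝 0) := tendsto_one_div_add_atTop_nhds_zero_nat
  have hεp : ∀ n, 0 < ε n := fun n => by positivity
  have hfin : ∀ n, ∃ t : Finset ℂ, (t : Set ℂ) ⊆ A ∧ ∀ m ∈ A, ∃ m' ∈ t, ‖m - m'‖ ≤ ε n := by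
    intro n
    obtain ⟨t, htA, htf, ht⟩ := Metric.finite_approx_of_totallyBounded
      (hA.isCompact_closure.totallyBounded.subset subset_closure) (ε n) (hεp n)
    refine ⟨htf.toFinset, by simpa using htA, fun m hm => ?_⟩
    obtain ⟨m', hm', hd⟩ := Set.mem_iUnion₂.1 (ht hm)
    exact ⟨m', by simpa using hm', by rw [← dist_eq_norm]; exact (Metric.mem_ball.1 hd).le⟩
  choose t htA ht using hfin
  have htne : ∀ n, (t n).Nonempty := fun n => by
    obtain ⟨m, hm⟩ := hne
    obtain ⟨m', hm', -⟩ := ht n m hm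
    exact ⟨m', hm'⟩
  let s : ℕ → X := fun n => (t n).sup' (htne n) fun m => L.re (m • z)
  have hub : ∀ n, ∀ m ∈ A, L.re (m • z) ≤ s n + ε n • L.modulus z := by
    intro n m hm
    obtain ⟨m', hm', hd⟩ := ht n m hm
    exact (hdiff m m' _ hd).trans
      (add_le_add_left (Finset.le_sup' (fun m : ℂ => L.re (m • z)) hm') _)
  have hle : ∀ n u, (∀ m ∈ A, L.re (m • z) ≤ u) → s n ≤ u := fun n u h =>
    Finset.sup'_le _ _ fun m hm => h m (htA n hm)
  have hdist : ∀ n m, n ≤ m → dist (s n) (s m) ≤ ε n * ‖L.modulus z‖ := by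
    intro n m hnm
    have hmn : ε m ≤ ε n := by
      simp only [ε]
      gcongr
    have h1 : s m ≤ s n + ε n • L.modulus z := hle _ _ (hub n)
    have h2 : s n ≤ s m + ε n • L.modulus z := (hle _ _ (hub m)).trans
      (add_le_add_right (smul_le_smul_of_nonneg_right hmn (L.modulus_nonneg z)) _)
    have h3 : |s n - s m| ≤ |ε n • L.modulus z| := by
      rw [abs_of_nonneg (smul_nonneg (hεp n).le (L.modulus_nonneg z))]
      refine abs_le'.2 ⟨sub_le_iff_le_add'.2 h2, ?_⟩
      rw [neg_sub]
      exact sub_le_iff_le_add'.2 h1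
    rw [dist_eq_norm]
    refine (norm_le_norm_of_abs_le_abs h3).trans ?_
    rw [norm_smul, Real.norm_of_nonneg (hεp n).le]
  have hcau : CauchySeq s := by
    refine cauchySeq_of_le_tendsto_0' (fun n => ε n * ‖L.modulus z‖) hdist ?_
    simpa using hε.mul_const ‖L.modulus z‖
  obtain ⟨x, hx⟩ := cauchySeq_tendsto_of_complete hcau
  refine ⟨x, ?_, ?_⟩
  · rintro _ ⟨m, hm, rfl⟩
    have : Tendsto (fun n => s n + ε n • L.modulus z) atTop (𝓝 (x + (0 : ℝ) • L.modulus z)) :=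
      hx.add (hε.smul_const _)
    rw [zero_smul, add_zero] at this
    exact ge_of_tendsto' this fun n => hub n m hm
  · intro u hu
    exact le_of_tendsto' hx fun n => hle n u fun m hm => hu ⟨m, hm, rfl⟩

/-- The second order Taylor estimate for the power `δ ↦ δ ^ k` on the unit circle: it differs from
`Re δ + i k Im δ`, the derivative at `1` of `δ ↦ |δ| sgn(δ) ^ k`, by at most the multiple
`C (1 - Re δ) = C |δ - 1|² / 2`. -/
def IsTaylorBound (k : ℤ) (C : ℝ) : Prop := 1 ≤ C ∧ ∀ δ : ℂ, ‖δ‖ = 1 →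
    ‖δ ^ k - ((δ.re : ℂ) + k * δ.im * Complex.I)‖ ≤ C * (1 - δ.re)

theorem exists_isTaylorBound (k : ℤ) : ∃ C : ℝ, IsTaylorBound k C := by
  have hsq : ∀ δ : ℂ, ‖δ‖ = 1 → ‖δ - 1‖ ^ 2 = 2 * (1 - δ.re) := fun δ h => by
    have : δ.re * δ.re + δ.im * δ.im = 1 := by
      rw [← Complex.normSq_apply, Complex.normSq_eq_norm_sq, h]; norm_num
    rw [← Complex.normSq_eq_norm_sq, Complex.normSq_apply]
    simp only [Complex.sub_re, Complex.sub_im, Complex.one_re, Complex.one_im]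
    linarith
  have hre : ∀ δ : ℂ, ‖δ‖ = 1 → 0 ≤ 1 - δ.re := fun δ h => by
    linarith [h ▸ Complex.re_le_norm δ]
  have hone : ∀ (n : ℕ) (δ : ℂ), ‖δ‖ = 1 → ‖δ ^ n - 1‖ ≤ n * ‖δ - 1‖ := by
    intro n δ h
    induction n with
    | zero => simp
    | succ n ih =>
      have e : δ ^ (n + 1) - 1 = δ * (δ ^ n - 1) + (δ - 1) := by ring
      rw [e]
      refine (norm_add_le _ _).trans ?_
      rw [norm_mul, h]
      push_cast
      linarith
  have htwo : ∀ (n : ℕ) (δ : ℂ), ‖δ‖ = 1 →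
      ‖δ ^ n - 1 - n * (δ - 1)‖ ≤ n ^ 2 * ‖δ - 1‖ ^ 2 := by
    intro n δ h
    induction n with
    | zero => simp
    | succ n ih =>
      have e : δ ^ (n + 1) - 1 - ((n + 1 : ℕ) : ℂ) * (δ - 1) =
          (δ ^ n - 1 - n * (δ - 1)) + (δ ^ n - 1) * (δ - 1) := by push_cast; ring
      rw [e]
      refine (norm_add_le _ _).trans ?_
      rw [norm_mul]
      have := mul_le_mul_of_nonneg_right (hone n δ h) (norm_nonneg (δ - 1))
      push_cast
      nlinarith [sq_nonneg ‖δ - 1‖, (Nat.cast_nonneg n : (0 : ℝ) ≤ n)]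
  have hnat : ∀ (n : ℕ) (δ : ℂ), ‖δ‖ = 1 →
      ‖δ ^ n - ((δ.re : ℂ) + n * δ.im * Complex.I)‖ ≤ (2 * n ^ 2 + n + 1) * (1 - δ.re) := by
    intro n δ h
    have e : δ ^ n - ((δ.re : ℂ) + n * δ.im * Complex.I) =
        (δ ^ n - 1 - n * (δ - 1)) + ((1 - n : ℝ) * (1 - δ.re : ℝ) : ℝ) := by
      conv_lhs => rw [show δ ^ n = (δ ^ n - 1 - n * (δ - 1)) + 1 + n * (δ - 1) by ring]
      conv_lhs => enter [1, 2, 2, 1]; rw [← Complex.re_add_im δ]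
      push_cast
      ring
    rw [e]
    refine (norm_add_le _ _).trans ?_
    have h1 := htwo n δ h
    rw [hsq δ h] at h1
    have h2 : ‖(((1 - n : ℝ) * (1 - δ.re : ℝ) : ℝ) : ℂ)‖ ≤ (n + 1) * (1 - δ.re) := by
      rw [Complex.norm_real, norm_mul, Real.norm_of_nonneg (hre δ h)]
      refine mul_le_mul_of_nonneg_right ?_ (hre δ h)
      rw [Real.norm_eq_abs, abs_le]
      have := (Nat.cast_nonneg n : (0 : ℝ) ≤ n)
      constructor <;> linarith
    nlinarith
  obtain ⟨n, rfl | rfl⟩ := k.eq_nat_or_neg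
  · refine ⟨2 * n ^ 2 + n + 1, ?_, fun δ h => ?_⟩
    · nlinarith [(Nat.cast_nonneg n : (0 : ℝ) ≤ n)]
    · simpa using hnat n δ h
  · refine ⟨2 * n ^ 2 + n + 1, ?_, fun δ h => ?_⟩
    · nlinarith [(Nat.cast_nonneg n : (0 : ℝ) ≤ n)]
    · have hc : ‖(starRingEnd ℂ) δ‖ = 1 := by rw [Complex.norm_conj, h]
      have h1 := hnat n _ hc
      have hinv : δ⁻¹ = (starRingEnd ℂ) δ := Complex.inv_eq_conj h
      rw [zpow_neg, ← inv_zpow, hinv, zpow_natCast]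
      simpa using h1

end ComplexBanachLattice

/-! ### Powers of the sign of an element -/

namespace ComplexBanachLattice

/-- The real linear functionals `ζ ↦ Re (m ζ)` on `ℂ`, encoded by `m`, which are dominated by the
positively homogeneous function `C |a| |ζ| - Re (a |ζ| sgn(ζ) ^ k)`. By homogeneity it is enough
to compare on the unit circle. -/
def powSupport (k : ℤ) (C : ℝ) (a : ℂ) : Set ℂ :=
  {m | ∀ ζ : ℂ, ‖ζ‖ = 1 → (m * ζ).re ≤ C * ‖a‖ - (a * ζ ^ k).re}

/-- The gradient of `C |a| |ζ| - Re (a |ζ| sgn(ζ) ^ k)` at the point `ζ = c⁻¹` of the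
unit circle. -/
noncomputable def powGradient (k : ℤ) (C : ℝ) (a c : ℂ) : ℂ :=
  c * ((C * ‖a‖ : ℝ) - ((a * c ^ (-k)).re + k * (a * c ^ (-k)).im * Complex.I))

section Support

variable {k : ℤ} {C : ℝ}

theorem norm_le_of_forall_re_le {m : ℂ} {ρ : ℝ} (h : ∀ ζ : ℂ, ‖ζ‖ = 1 → (m * ζ).re ≤ ρ) :
    ‖m‖ ≤ ρ := by
  by_cases hm : m = 0
  · have h1 := h 1 (by simp)
    simpa [hm] using h1
  · have hm' : (‖m‖ : ℂ) ≠ 0 := by simpa using hm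
    have h1 := h ((starRingEnd ℂ) m / ‖m‖) (by
      rw [norm_div, Complex.norm_conj, Complex.norm_real, norm_norm, div_self (by simpa using hm)])
    have e : m * ((starRingEnd ℂ) m / ‖m‖) = (‖m‖ : ℂ) := by
      rw [← mul_div_assoc, Complex.mul_conj, Complex.normSq_eq_norm_sq]
      push_cast
      field_simp
    rwa [e, Complex.ofReal_re] at h1

theorem norm_zpow_eq_one {ζ : ℂ} (h : ‖ζ‖ = 1) (k : ℤ) : ‖ζ ^ k‖ = 1 := by
  rw [norm_zpow, h, one_zpow]

theorem norm_le_of_mem_powSupport {a m : ℂ} (hm : m ∈ powSupport k C a) :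
    ‖m‖ ≤ (C + 1) * ‖a‖ := by
  refine norm_le_of_forall_re_le fun ζ hζ => (hm ζ hζ).trans ?_
  have h := (Complex.abs_re_le_norm (a * ζ ^ k))
  rw [norm_mul, norm_zpow_eq_one hζ, mul_one] at h
  linarith [(abs_le.1 h).1]

/-- The function `C |a| |ζ| - Re (a |ζ| sgn(ζ) ^ k)` lies above its tangents, i.e. it is
sublinear. This is what the Taylor estimate is for. -/
theorem powGradient_mem (hC : IsTaylorBound k C) (a : ℂ) {c : ℂ} (hc : ‖c‖ = 1) :
    powGradient k C a c ∈ powSupport k C a := by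
  intro ζ hζ
  have hc0 : c ≠ 0 := fun h => by simp [h] at hc
  set δ := c * ζ with hδ
  have hδ1 : ‖δ‖ = 1 := by rw [hδ, norm_mul, hc, hζ, one_mul]
  set w := a * c ^ (-k) with hw
  have hwa : ‖w‖ = ‖a‖ := by rw [hw, norm_mul, norm_zpow_eq_one hc, mul_one]
  have e1 : a * ζ ^ k = w * δ ^ k := by
    rw [hw, hδ, mul_zpow, zpow_neg]
    have := zpow_ne_zero k hc0
    field_simp
  have e2 : powGradient k C a c * ζ =
      ((C * ‖a‖ : ℝ) - (w.re + k * w.im * Complex.I)) * δ := by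
    rw [powGradient, hδ]; ring
  rw [e1, e2]
  have h := (Complex.re_le_norm (w * (δ ^ k - ((δ.re : ℂ) + k * δ.im * Complex.I))))
  rw [norm_mul, hwa] at h
  have h2 := h.trans (mul_le_mul_of_nonneg_left (hC.2 δ hδ1) (norm_nonneg a))
  rw [mul_sub, Complex.sub_re] at h2
  have e3 : (w * ((δ.re : ℂ) + k * δ.im * Complex.I)).re = w.re * δ.re - k * w.im * δ.im := by
    simp [Complex.mul_re, Complex.mul_im]; ring
  have e4 : (((C * ‖a‖ : ℝ) - (w.re + k * w.im * Complex.I)) * δ).re =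
      C * ‖a‖ * δ.re - w.re * δ.re + k * w.im * δ.im := by
    simp [Complex.mul_re, Complex.mul_im]; ring
  rw [e3] at h2
  rw [e4]
  linarith

theorem powSupport_nonempty (hC : IsTaylorBound k C) (a : ℂ) : (powSupport k C a).Nonempty :=
  ⟨_, powGradient_mem hC a norm_one⟩

theorem isBounded_powSupport (a : ℂ) : Bornology.IsBounded (powSupport k C a) :=
  isBounded_iff_forall_norm_le.2 ⟨_, fun _ hm => norm_le_of_mem_powSupport hm⟩

theorem smul_mem_powSupport {t : ℝ} (ht : 0 ≤ t) {a m : ℂ} (hm : m ∈ powSupport k C a) :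
    (t : ℂ) * m ∈ powSupport k C (t * a) := by
  intro ζ hζ
  have h := mul_le_mul_of_nonneg_left (hm ζ hζ) ht
  rw [mul_assoc, mul_assoc, Complex.re_ofReal_mul, Complex.re_ofReal_mul, norm_mul,
    Complex.norm_real, Real.norm_of_nonneg ht]
  linarith

theorem mul_mem_powSupport {a m μ : ℂ} (hμ : ‖μ‖ = 1) (hm : m ∈ powSupport k C (a * μ ^ k)) :
    m * μ⁻¹ ∈ powSupport k C a := by
  intro ζ hζ
  have hμ0 : μ ≠ 0 := fun h => by simp [h] at hμ
  have h := hm (μ⁻¹ * ζ) (by rw [norm_mul, norm_inv, hμ, hζ]; norm_num)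
  have e : a * μ ^ k * (μ⁻¹ * ζ) ^ k = a * ζ ^ k := by
    rw [mul_zpow, inv_zpow]
    have := zpow_ne_zero k hμ0
    field_simp
  rwa [e, norm_mul, norm_zpow_eq_one hμ, mul_one, ← mul_assoc] at h

end Support

variable {X E : Type*}
  [NormedAddCommGroup X] [NormedSpace ℝ X] [CompleteSpace X]
  [Lattice X] [IsOrderedAddMonoid X] [IsOrderedModule ℝ X] [HasSolidNorm X]
  [NormedAddCommGroup E] [NormedSpace ℂ E] [CompleteSpace E]
  (L : ComplexBanachLattice X E) {k : ℤ} {C : ℝ}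

/-- The element `C |a| |z| - Re (a |z| sgn(z) ^ k)` of `X`, constructed as the supremum of the
linear functionals in `powSupport k C a`. -/
noncomputable def powSup (hC : IsTaylorBound k C) (a : ℂ) (z : E) : X :=
  (L.exists_isLUB_re_smul (isBounded_powSupport a) (powSupport_nonempty hC a) z).choose

theorem isLUB_powSup (hC : IsTaylorBound k C) (a : ℂ) (z : E) :
    IsLUB ((fun m : ℂ => L.re (m • z)) '' powSupport k C a) (L.powSup hC a z) :=
  (L.exists_isLUB_re_smul (isBounded_powSupport a) (powSupport_nonempty hC a) z).choose_spec

variable (hC : IsTaylorBound k C)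

theorem le_powSup {a m : ℂ} (hm : m ∈ powSupport k C a) (z : E) :
    L.re (m • z) ≤ L.powSup hC a z :=
  (L.isLUB_powSup hC a z).1 ⟨m, hm, rfl⟩

theorem powSup_le {a : ℂ} {z : E} {x : X} (h : ∀ m ∈ powSupport k C a, L.re (m • z) ≤ x) :
    L.powSup hC a z ≤ x := by
  refine (L.isLUB_powSup hC a z).2 ?_
  rintro _ ⟨m, hm, rfl⟩
  exact h m hm

theorem re_smul_le_of_norm_le {m : ℂ} {ρ : ℝ} (h : ‖m‖ ≤ ρ) (z : E) :
    L.re (m • z) ≤ ρ • L.modulus z :=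
  (L.re_smul_le m z).trans (smul_le_smul_of_nonneg_right h (L.modulus_nonneg z))

/-- The element of `X` which stands for `Re (a |z| sgn(z) ^ k)`. -/
noncomputable def powRe (a : ℂ) (z : E) : X := (C * ‖a‖) • L.modulus z - L.powSup hC a z

theorem smul_modulus_le {ρ : ℝ} (hρ : 0 ≤ ρ) {z : E} {x : X}
    (h : ∀ c : ℂ, ‖c‖ = 1 → L.re (((ρ : ℂ) * c) • z) ≤ x) : ρ • L.modulus z ≤ x := by
  rcases hρ.eq_or_lt with rfl | hρ
  · simpa using h 1 norm_one
  · rw [← le_inv_smul_iff_of_pos hρ]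
    refine L.modulus_le fun c hc => ?_
    rw [le_inv_smul_iff_of_pos hρ, ← map_smul, ← Complex.coe_smul, smul_smul]
    exact h c hc

/-- The relation `Re ((a + b + c) |z| sgn(z) ^ k) = 0` holds for the three suprema: the sum of
three supporting functionals is bounded by `C (|a| + |b| + |c|) |·|`, and the sum of
the gradients at a common point attains this bound. -/
theorem powRe_add_add {a b c : ℂ} (h : a + b + c = 0) (z : E) :
    L.powRe hC a z + L.powRe hC b z + L.powRe hC c z = 0 := by
  have key : L.powSup hC a z + L.powSup hC b z + L.powSup hC c z =
      (C * (‖a‖ + ‖b‖ + ‖c‖)) • L.modulus z := by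
    refine le_antisymm ?_ ?_
    · rw [add_assoc, ← le_sub_iff_add_le]
      refine L.powSup_le hC fun m hm => ?_
      rw [le_sub_comm, ← le_sub_iff_add_le]
      refine L.powSup_le hC fun n hn => ?_
      rw [le_sub_comm]
      refine L.powSup_le hC fun p hp => ?_
      rw [le_sub_iff_add_le, le_sub_iff_add_le, ← map_add, ← map_add, ← add_smul, ← add_smul]
      refine L.re_smul_le_of_norm_le (norm_le_of_forall_re_le fun ζ hζ => ?_) z
      have h1 := hm ζ hζ
      have h2 := hn ζ hζ
      have h3 := hp ζ hζ
      have h4 : (a * ζ ^ k).re + (b * ζ ^ k).re + (c * ζ ^ k).re = 0 := by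
        rw [← Complex.add_re, ← Complex.add_re, ← add_mul, ← add_mul, h, zero_mul, Complex.zero_re]
      rw [add_mul, add_mul, Complex.add_re, Complex.add_re]
      linarith
    · have hpos : 0 ≤ C * (‖a‖ + ‖b‖ + ‖c‖) := by
        have := hC.1
        positivity
      refine L.smul_modulus_le hpos fun d hd => ?_
      have e : ((C * (‖a‖ + ‖b‖ + ‖c‖) : ℝ) : ℂ) * d =
          powGradient k C a d + powGradient k C b d + powGradient k C c d := by
        have h1 : (a * d ^ (-k)).re + (b * d ^ (-k)).re + (c * d ^ (-k)).re = 0 := by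
          rw [← Complex.add_re, ← Complex.add_re, ← add_mul, ← add_mul, h, zero_mul,
            Complex.zero_re]
        have h2 : (a * d ^ (-k)).im + (b * d ^ (-k)).im + (c * d ^ (-k)).im = 0 := by
          rw [← Complex.add_im, ← Complex.add_im, ← add_mul, ← add_mul, h, zero_mul,
            Complex.zero_im]
        have h1' := congrArg (fun t : ℝ => (t : ℂ)) h1
        have h2' := congrArg (fun t : ℝ => (t : ℂ)) h2
        simp only [Complex.ofReal_add, Complex.ofReal_zero] at h1' h2'
        simp only [powGradient]
        push_cast
        linear_combination d * h1' + d * k * Complex.I * h2'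
      rw [e, add_smul, add_smul, map_add, map_add]
      exact add_le_add (add_le_add (L.le_powSup hC (powGradient_mem hC a hd) z)
        (L.le_powSup hC (powGradient_mem hC b hd) z)) (L.le_powSup hC (powGradient_mem hC c hd) z)
  have e : L.powRe hC a z + L.powRe hC b z + L.powRe hC c z =
      (C * (‖a‖ + ‖b‖ + ‖c‖)) • L.modulus z -
        (L.powSup hC a z + L.powSup hC b z + L.powSup hC c z) := by
    simp only [powRe]
    module
  rw [e, key, sub_self]

theorem powRe_zero (z : E) : L.powRe hC 0 z = 0 := by
  have h := L.powRe_add_add hC (a := 0) (b := 0) (c := 0) (by simp) z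
  have h3 : (3 : ℝ) • L.powRe hC 0 z = 0 := by
    rw [← h]; module
  exact (smul_eq_zero.1 h3).resolve_left (by norm_num)

theorem powRe_neg (a : ℂ) (z : E) : L.powRe hC (-a) z = -L.powRe hC a z := by
  have h := L.powRe_add_add hC (a := -a) (b := a) (c := 0) (by simp) z
  rw [powRe_zero, add_zero] at h
  exact eq_neg_of_add_eq_zero_left h

theorem powRe_add (a b : ℂ) (z : E) :
    L.powRe hC (a + b) z = L.powRe hC a z + L.powRe hC b z := by
  have h := L.powRe_add_add hC (a := a) (b := b) (c := -(a + b)) (by ring) z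
  rw [powRe_neg, add_neg_eq_zero] at h
  exact h.symm

theorem powSup_mul_le {t : ℝ} (ht : 0 < t) (a : ℂ) (z : E) :
    t • L.powSup hC a z ≤ L.powSup hC (t * a) z := by
  rw [← le_inv_smul_iff_of_pos ht]
  refine L.powSup_le hC fun m hm => ?_
  rw [le_inv_smul_iff_of_pos ht, ← map_smul, ← Complex.coe_smul, smul_smul]
  exact L.le_powSup hC (smul_mem_powSupport ht.le hm) z

theorem powRe_mul_of_pos {t : ℝ} (ht : 0 < t) (a : ℂ) (z : E) :
    L.powRe hC (t * a) z = t • L.powRe hC a z := by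
  have h : L.powSup hC (t * a) z = t • L.powSup hC a z := by
    refine le_antisymm ?_ (L.powSup_mul_le hC ht a z)
    have h1 := L.powSup_mul_le hC (inv_pos.2 ht) (t * a) z
    have e : ((t⁻¹ : ℝ) : ℂ) * (t * a) = a := by
      have : (t : ℂ) ≠ 0 := by exact_mod_cast ht.ne'
      push_cast
      field_simp
    rwa [e, inv_smul_le_iff_of_pos ht] at h1
  rw [powRe, powRe, h, norm_mul, Complex.norm_real, Real.norm_of_nonneg ht.le]
  module

theorem powRe_mul (t : ℝ) (a : ℂ) (z : E) : L.powRe hC (t * a) z = t • L.powRe hC a z := by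
  rcases lt_trichotomy t 0 with ht | rfl | ht
  · have h := L.powRe_mul_of_pos hC (neg_pos.2 ht) a z
    rw [Complex.ofReal_neg, neg_mul, powRe_neg, neg_smul] at h
    exact neg_injective h
  · simp [powRe_zero]
  · exact L.powRe_mul_of_pos hC ht a z

theorem powRe_rotate {μ : ℂ} (hμ : ‖μ‖ = 1) (a : ℂ) (z : E) :
    L.powRe hC a (μ • z) = L.powRe hC (a * μ ^ k) z := by
  have hμ0 : μ ≠ 0 := fun h => by simp [h] at hμ
  have h : ∀ (ν : ℂ) (b : ℂ) (w : E), ‖ν‖ = 1 →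
      L.powSup hC (b * ν ^ k) w ≤ L.powSup hC b (ν • w) := by
    intro ν b w hν
    have hν0 : ν ≠ 0 := fun h => by simp [h] at hν
    refine L.powSup_le hC fun m hm => ?_
    have h1 := L.le_powSup hC (mul_mem_powSupport hν hm) (ν • w)
    rwa [smul_smul, mul_assoc, inv_mul_cancel₀ hν0, mul_one] at h1
  have e : L.powSup hC a (μ • z) = L.powSup hC (a * μ ^ k) z := by
    refine le_antisymm ?_ (h μ a z hμ)
    have h1 := h μ⁻¹ (a * μ ^ k) (μ • z) (by rw [norm_inv, hμ, inv_one])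
    rwa [inv_zpow, mul_assoc, mul_inv_cancel₀ (zpow_ne_zero k hμ0), mul_one, smul_smul,
      inv_mul_cancel₀ hμ0, one_smul] at h1
  rw [powRe, powRe, e, L.modulus_smul_of_norm_eq_one hμ, norm_mul, norm_zpow_eq_one hμ, mul_one]

theorem powRe_sub_le (a : ℂ) (z w : E) :
    L.powRe hC a z - L.powRe hC a w ≤ ((2 * C + 1) * ‖a‖) • L.modulus (z - w) := by
  have hCn : 0 ≤ C * ‖a‖ := mul_nonneg (zero_le_one.trans hC.1) (norm_nonneg a)
  have h1 : L.powSup hC a w ≤ L.powSup hC a z + ((C + 1) * ‖a‖) • L.modulus (z - w) := by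
    refine L.powSup_le hC fun m hm => ?_
    have e : m • w = m • z + (-m) • (z - w) := by module
    rw [e, map_add]
    refine add_le_add (L.le_powSup hC hm z) (L.re_smul_le_of_norm_le ?_ _)
    rw [norm_neg]
    exact norm_le_of_mem_powSupport hm
  have h2 : L.modulus z ≤ L.modulus w + L.modulus (z - w) := by
    simpa using L.modulus_add_le w (z - w)
  have h3 := smul_le_smul_of_nonneg_left h2 hCn
  have h4 := add_le_add h1 h3
  rw [powRe, powRe]
  rw [← sub_nonneg] at h4 ⊢
  convert h4 using 1
  module

/-- A Jensen inequality: a positive operator maps a supremum of functionals above the supremum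
of the functionals of the image. -/
theorem realOp_powRe_sub_le {T : E →L[ℂ] E} (hT : L.IsPositiveOperator T) (a : ℂ) (z : E) :
    L.realOp T (L.powRe hC a z) - L.powRe hC a (T z) ≤
      (C * ‖a‖) • (L.realOp T (L.modulus z) - L.modulus (T z)) := by
  have h : L.powSup hC a (T z) ≤ L.realOp T (L.powSup hC a z) := by
    refine L.powSup_le hC fun m hm => ?_
    rw [← map_smul, hT.re_apply]
    exact hT.realOp_mono (L.le_powSup hC hm z)
  rw [powRe, powRe, map_sub, map_smul]
  rw [← sub_nonneg] at h ⊢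
  convert h using 1
  module

/-- The lower bound `ρ - (C + 1) ρ (1 - Re (c ζ)) ≤ ρ Re ((c ζ) ^ k)`, for `ρ ≥ 0` and `|ζ| = 1`,
in the lattice. -/
theorem modulus_sub_le_powRe {c : ℂ} (hc : ‖c‖ = 1) (z : E) :
    L.modulus z - (C + 1) • (L.modulus z - L.re (c • z)) ≤ L.powRe hC (c ^ k) z := by
  have hck : ‖c ^ k‖ = 1 := norm_zpow_eq_one hc k
  have h : L.powSup hC (c ^ k) z ≤
      (2 * C) • L.modulus z - (C + 1) • L.re (c • z) := by
    refine L.powSup_le hC fun m hm => ?_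
    rw [le_sub_iff_add_le, ← map_smul, ← map_add, ← Complex.coe_smul, smul_smul, ← add_smul]
    refine L.re_smul_le_of_norm_le (norm_le_of_forall_re_le fun ζ hζ => ?_) z
    have h1 := hm ζ hζ
    rw [hck, mul_one, ← mul_zpow] at h1
    have hδ : ‖c * ζ‖ = 1 := by rw [norm_mul, hc, hζ, one_mul]
    have h2 := (abs_le.1 (Complex.abs_re_le_norm _)).1.trans' (neg_le_neg (hC.2 _ hδ))
    have e : ((c * ζ) ^ k - (((c * ζ).re : ℂ) + k * (c * ζ).im * Complex.I)).re =
        ((c * ζ) ^ k).re - (c * ζ).re := by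
      simp [Complex.mul_re, Complex.mul_im]
    rw [e] at h2
    rw [add_mul, Complex.add_re, mul_assoc, Complex.re_ofReal_mul]
    linarith
  rw [powRe, hck]
  rw [← sub_nonneg] at h ⊢
  convert h using 1
  module

/-- The element `|z| sgn(z) ^ k` of `E`, where `sgn z` stands for `z / |z|`, assembled from
the real parts `powRe` of its multiples by `1` and `-i`. It depends on `C` only formally. -/
noncomputable def signPow (z : E) : E :=
  L.ofReal (L.powRe hC 1 z) + Complex.I • L.ofReal (-L.powRe hC Complex.I z)

theorem re_smul_signPow (a : ℂ) (z : E) : L.re (a • L.signPow hC z) = L.powRe hC a z := by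
  rw [re_smul, signPow, (L.re_im_mk _ _).1, (L.re_im_mk _ _).2, smul_neg, sub_neg_eq_add,
    ← powRe_mul, ← powRe_mul, ← powRe_add, mul_one, Complex.re_add_im]

theorem signPow_smul {μ : ℂ} (hμ : ‖μ‖ = 1) (z : E) :
    L.signPow hC (μ • z) = μ ^ k • L.signPow hC z := by
  refine L.ext_re fun a => ?_
  rw [smul_smul, re_smul_signPow, re_smul_signPow, powRe_rotate L hC hμ]

theorem modulus_signPow_sub_le (z w : E) :
    L.modulus (L.signPow hC z - L.signPow hC w) ≤ (2 * C + 1) • L.modulus (z - w) := by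
  refine L.modulus_le fun a ha => ?_
  rw [smul_sub, map_sub, re_smul_signPow, re_smul_signPow]
  simpa [ha] using L.powRe_sub_le hC a z w

theorem signPow_zero : L.signPow hC 0 = 0 := by
  have h : ∀ a, L.powRe hC a (0 : E) = 0 := by
    intro a
    have h0 : L.modulus (0 : E) = 0 := by
      have := L.norm_modulus (0 : E)
      rwa [norm_zero, norm_eq_zero] at this
    have h1 : L.powSup hC a (0 : E) = 0 := by
      refine le_antisymm (L.powSup_le hC fun m _ => by simp) ?_
      simpa using L.le_powSup hC (powGradient_mem hC a norm_one) (0 : E)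
    rw [powRe, h0, h1, smul_zero, sub_zero]
  rw [signPow, h, h]
  simp

theorem modulus_signPow_le (z : E) : L.modulus (L.signPow hC z) ≤ (2 * C + 1) • L.modulus z := by
  simpa [signPow_zero] using L.modulus_signPow_sub_le hC z 0

/-- The modulus of `|z| sgn(z) ^ k` is at least `|z|`: on a function lattice the deficit would be
`(C + 1) (|z| - Re (c z))` at most, for each `c`, and the infimum of this over `c` is zero. -/
theorem modulus_le_modulus_signPow (z : E) : L.modulus z ≤ L.modulus (L.signPow hC z) := by
  have hC1 : 0 < C + 1 := by linarith [hC.1]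
  have h : ∀ c : ℂ, ‖c‖ = 1 → L.re (c • z) ≤
      L.modulus z - (C + 1)⁻¹ • (L.modulus z - L.modulus (L.signPow hC z)) := by
    intro c hc
    have h1 := L.modulus_sub_le_powRe hC hc z
    rw [← re_smul_signPow] at h1
    have h2 := h1.trans (L.re_smul_le_of_norm_le (norm_zpow_eq_one hc k).le _)
    rw [one_smul, sub_le_comm] at h2
    rw [le_sub_comm, inv_smul_le_iff_of_pos hC1]
    exact h2
  have h3 := L.modulus_le h
  rw [le_sub_self_iff] at h3
  have h4 := smul_le_smul_of_nonneg_left h3 hC1.le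
  rw [smul_inv_smul₀ hC1.ne', smul_zero] at h4
  exact sub_nonpos.1 h4

/-- A positive operator commutes with `z ↦ |z| sgn(z) ^ k` up to a multiple of the defect
`T|z| - |T z|`. -/
theorem modulus_apply_signPow_sub_le {T : E →L[ℂ] E} (hT : L.IsPositiveOperator T) (z : E) :
    L.modulus (T (L.signPow hC z) - L.signPow hC (T z)) ≤
      C • (L.realOp T (L.modulus z) - L.modulus (T z)) := by
  refine L.modulus_le fun a ha => ?_
  rw [smul_sub, map_sub, re_smul_signPow, ← map_smul, hT.re_apply, re_smul_signPow]
  simpa [ha] using L.realOp_powRe_sub_le hC hT a z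

end ComplexBanachLattice

/-! ### Resolvents -/

section Resolvent

variable {A : Type*} [NormedRing A] [NormedAlgebra ℂ A]

theorem resolvent_mul_sub {a : A} {μ : ℂ} (h : μ ∈ resolventSet ℂ a) :
    resolvent a μ * (algebraMap ℂ A μ - a) = 1 :=
  Ring.inverse_mul_cancel _ h

theorem sub_mul_resolvent {a : A} {μ : ℂ} (h : μ ∈ resolventSet ℂ a) :
    (algebraMap ℂ A μ - a) * resolvent a μ = 1 :=
  Ring.mul_inverse_cancel _ h

theorem resolvent_sub_resolvent_eq_smul_mul {a : A} {μ ν : ℂ} (hμ : μ ∈ resolventSet ℂ a)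
    (hν : ν ∈ resolventSet ℂ a) :
    resolvent a μ - resolvent a ν = (ν - μ) • (resolvent a μ * resolvent a ν) := by
  have h : resolvent a μ * ((algebraMap ℂ A ν - a) - (algebraMap ℂ A μ - a)) * resolvent a ν =
      resolvent a μ - resolvent a ν := by
    rw [mul_sub, sub_mul, resolvent_mul_sub hμ, mul_assoc, sub_mul_resolvent hν, mul_one, one_mul]
  rw [← h, sub_sub_sub_cancel_right, ← map_sub, ← Algebra.commutes, mul_assoc,
    Algebra.algebraMap_eq_smul_one, smul_mul_assoc, one_mul]

variable [CompleteSpace A]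

theorem continuousAt_resolvent {a : A} {μ : ℂ} (h : μ ∈ resolventSet ℂ a) :
    ContinuousAt (resolvent a) μ :=
  (spectrum.hasDerivAt_resolvent_const_left h).continuousAt

/-- The Neumann series of the resolvent converges outside the spectral disc. -/
theorem hasSum_resolvent {a : A} {μ : ℂ} (h : spectralRadius ℂ a < ‖μ‖₊) :
    HasSum (fun n : ℕ => μ⁻¹ ^ (n + 1) • a ^ n) (resolvent a μ) := by
  have hμ0 : μ ≠ 0 := by
    rintro rfl
    simp at h
  obtain ⟨ρ, hρ, hρμ⟩ := ENNReal.lt_iff_exists_nnreal_btwn.1 h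
  have hρ0 : 0 < ρ := by
    have : (0 : ℝ≥0∞) < ρ := bot_le.trans_lt hρ
    exact_mod_cast this
  have hρ1 : ((ρ⁻¹ : NNReal) : ℝ≥0∞) < (spectralRadius ℂ a)⁻¹ := by
    rw [ENNReal.coe_inv hρ0.ne']
    exact ENNReal.inv_lt_inv.2 hρ
  have H₁ := (spectrum.differentiableOn_inverse_one_sub_smul hρ1).hasFPowerSeriesOnBall
    (inv_pos.2 hρ0)
  have H₂ := (spectrum.hasFPowerSeriesOnBall_inverse_one_sub_smul ℂ a).exchange_radius H₁
  have hρμ' : ρ < ‖μ‖₊ := by exact_mod_cast hρμ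
  have hmem : μ⁻¹ ∈ Metric.eball (0 : ℂ) (ρ⁻¹ : NNReal) := by
    rw [Metric.mem_eball, edist_zero_right, enorm_eq_nnnorm, nnnorm_inv]
    exact_mod_cast inv_strictAnti₀ hρ0 hρμ'
  have H₃ := (H₂.hasSum hmem).const_smul μ⁻¹
  have e : μ⁻¹ • Ring.inverse (1 - μ⁻¹ • a) = resolvent a μ := by
    have := spectrum.units_smul_resolvent_self (r := Units.mk0 μ hμ0) (a := a)
    have h2 := congrArg (fun b : A => μ⁻¹ • b) this
    simp only [Units.smul_def, Units.val_mk0, inv_smul_smul₀ hμ0, Units.val_inv_eq_inv_val,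
      resolvent, map_one] at h2
    exact h2.symm
  rw [zero_add, e] at H₃
  refine H₃.congr_fun fun n => ?_
  simp [smul_smul, pow_succ']

end Resolvent

/-- The vectors witnessing that `lam` is an approximate eigenvalue if the resolvent
blows up along a sequence approaching `lam`. -/
theorem exists_norm_apply_sub_smul_le {E : Type*} [NormedAddCommGroup E] [NormedSpace ℂ E]
    [CompleteSpace E] {T : E →L[ℂ] E} {lam : ℂ} {ν : ℕ → ℂ} (hν : Tendsto ν atTop (𝓝 lam))
    (hres : ∀ n, ν n ∈ resolventSet ℂ T)
    (hinf : Tendsto (fun n => ‖resolvent T (ν n)‖) atTop atTop) {δ : ℝ} (hδ : 0 < δ) :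
    ∃ y : E, y ≠ 0 ∧ ‖T y - lam • y‖ ≤ δ * ‖y‖ := by
  have h1 : ∀ᶠ n in atTop, ‖ν n - lam‖ < δ / 2 := by
    have := (Metric.tendsto_nhds.1 hν) (δ / 2) (half_pos hδ)
    simpa [dist_eq_norm] using this
  obtain ⟨n, hn1, hn2⟩ := (h1.and (hinf.eventually_gt_atTop (2 / δ))).exists
  obtain ⟨x, hx⟩ : ∃ x, 2 / δ * ‖x‖ < ‖resolvent T (ν n) x‖ := by
    by_contra! hcon
    exact hn2.not_ge (ContinuousLinearMap.opNorm_le_bound _ (by positivity) hcon)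
  set y := resolvent T (ν n) x with hy
  have hypos : 0 < ‖y‖ := (by positivity : (0 : ℝ) ≤ 2 / δ * ‖x‖).trans_lt hx
  refine ⟨y, norm_pos_iff.1 hypos, ?_⟩
  have hxy : ν n • y - T y = x := by
    have := congrArg (fun S : E →L[ℂ] E => S x) (sub_mul_resolvent (hres n))
    simpa [Algebra.algebraMap_eq_smul_one] using this
  have e : T y - lam • y = (ν n - lam) • y - x := by
    rw [← hxy, sub_smul]; abel
  have hx' : ‖x‖ ≤ δ / 2 * ‖y‖ := by
    have := mul_le_mul_of_nonneg_left hx.le (half_pos hδ).le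
    have e2 : δ / 2 * (2 / δ * ‖x‖) = ‖x‖ := by field_simp
    rwa [e2] at this
  rw [e]
  refine (norm_sub_le _ _).trans ?_
  rw [norm_smul]
  nlinarith

namespace ComplexBanachLattice

variable {X E : Type*}
  [NormedAddCommGroup X] [NormedSpace ℝ X] [CompleteSpace X]
  [Lattice X] [IsOrderedAddMonoid X] [IsOrderedModule ℝ X] [HasSolidNorm X]
  [NormedAddCommGroup E] [NormedSpace ℂ E] [CompleteSpace E]
  {L : ComplexBanachLattice X E} {T : E →L[ℂ] E}

namespace IsPositiveOperator

theorem resolvent (hT : L.IsPositiveOperator T) {s : ℝ} (hs : 0 < s)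
    (hrad : spectralRadius ℂ T < ENNReal.ofReal s) :
    L.IsPositiveOperator (resolvent T (s : ℂ)) := by
  intro z hz
  have hs' : spectralRadius ℂ T < ‖(s : ℂ)‖₊ := by
    rwa [← enorm_eq_nnnorm, ← ofReal_norm, Complex.norm_real, Real.norm_of_nonneg hs.le]
  have hsum := (hasSum_resolvent hs').mapL (ContinuousLinearMap.apply ℂ E z)
  refine L.isClosed_positiveCone.mem_of_tendsto hsum (Eventually.of_forall fun t => ?_)
  refine Finset.sum_induction _ (· ∈ L.positiveCone) ?_ ?_ fun n _ => ?_
  · rintro _ _ ⟨x, hx, rfl⟩ ⟨y, hy, rfl⟩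
    exact ⟨x + y, add_nonneg hx hy, map_add _ _ _⟩
  · exact ⟨0, le_rfl, map_zero _⟩
  · obtain ⟨x, hx, hx'⟩ := hT.pow n hz
    refine ⟨(s⁻¹ ^ (n + 1)) • x, smul_nonneg (by positivity) hx, ?_⟩
    rw [map_smul, hx', ← Complex.coe_smul]
    simp

/-- The resolvent of a positive operator is dominated by its values on the positive axis. -/
theorem modulus_resolvent_le (hT : L.IsPositiveOperator T) {μ : ℂ}
    (hrad : spectralRadius ℂ T < ‖μ‖₊) (z : E) :
    L.modulus (_root_.resolvent T μ z) ≤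
      L.realOp (_root_.resolvent T (‖μ‖ : ℂ)) (L.modulus z) := by
  have hrad' : spectralRadius ℂ T < ‖(‖μ‖ : ℂ)‖₊ := by
    rwa [← enorm_eq_nnnorm, ← ofReal_norm, Complex.norm_real, norm_norm,
      ofReal_norm]
  refine L.modulus_le fun a ha => ?_
  have h1 := (((hasSum_resolvent hrad).mapL (ContinuousLinearMap.apply ℂ E z)).const_smul a).mapL
    L.reCLM
  have h2 := ((hasSum_resolvent hrad').mapL
    (ContinuousLinearMap.apply ℂ E (L.ofReal (L.modulus z)))).mapL L.reCLM
  refine hasSum_le (fun n => ?_) h1 h2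
  have e : ((‖μ‖ : ℂ)⁻¹ ^ (n + 1)) = ((‖μ‖⁻¹ ^ (n + 1) : ℝ) : ℂ) := by push_cast; rfl
  simp only [ContinuousLinearMap.apply_apply, smul_apply, reCLM_apply]
  rw [smul_smul, e, Complex.coe_smul, map_smul L.re (‖μ‖⁻¹ ^ (n + 1) : ℝ), ← realOp_apply]
  refine (L.re_smul_le _ _).trans ?_
  rw [norm_mul, ha, one_mul, norm_pow, norm_inv]
  exact smul_le_smul_of_nonneg_left ((hT.pow n).modulus_apply_le z) (by positivity)

end IsPositiveOperator

end ComplexBanachLattice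

/-! ### From approximate eigenvectors to the resolvent estimate -/

namespace ComplexBanachLattice

variable {X E : Type*}
  [NormedAddCommGroup X] [NormedSpace ℝ X] [CompleteSpace X]
  [Lattice X] [IsOrderedAddMonoid X] [IsOrderedModule ℝ X] [HasSolidNorm X]
  [NormedAddCommGroup E] [NormedSpace ℂ E] [CompleteSpace E]
  {L : ComplexBanachLattice X E} {T : E →L[ℂ] E} {k : ℤ} {C : ℝ}

/-- If `y` is an approximate eigenvector of `T` for `lam`, then `|y| sgn(y) ^ k` fails to be an
eigenvector for `lam ^ k` by no more than a multiple of `T|y| - |y|`, up to the defect of `y`. -/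
theorem modulus_apply_signPow_sub_smul_le (hC : IsTaylorBound k C) (hT : L.IsPositiveOperator T)
    {lam : ℂ} (hlam : ‖lam‖ = 1) (y : E) :
    L.modulus (T (L.signPow hC y) - lam ^ k • L.signPow hC y) ≤
      C • (L.realOp T (L.modulus y) - L.modulus y) +
        (3 * C + 1) • L.modulus (T y - lam • y) := by
  have h1 := L.modulus_apply_signPow_sub_le hC hT y
  have h2 := L.modulus_signPow_sub_le hC (T y) (lam • y)
  rw [L.signPow_smul hC hlam] at h2
  have h3 := L.modulus_add_le (T (L.signPow hC y) - L.signPow hC (T y))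
    (L.signPow hC (T y) - lam ^ k • L.signPow hC y)
  rw [sub_add_sub_cancel] at h3
  have h4 : L.modulus y ≤ L.modulus (T y) + L.modulus (T y - lam • y) := by
    have := L.modulus_add_le (T y) (-(T y - lam • y))
    rwa [L.modulus_neg, neg_sub, add_sub_cancel, L.modulus_smul_of_norm_eq_one hlam] at this
  have h5 := smul_le_smul_of_nonneg_left h4 (zero_le_one.trans hC.1)
  have h6 := add_le_add h3 (add_le_add (add_le_add h1 h2) h5)
  rw [← sub_nonneg] at h6 ⊢
  convert h6 using 1
  module

/-- If `lam ^ k` belongs to the resolvent set, then the norm of a vector `y` is bounded by its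
defect `T y - lam y`, up to a multiple of `‖y‖` whose coefficient has the order
`(r - 1) (s - 1) ^ 2 ‖R(r, T)‖`. The assumption on `q` says that `s - 1` is a sufficiently large
multiple of `r - 1`. -/
theorem norm_le_of_approx_eigenvector (hC : IsTaylorBound k C) (hT : L.IsPositiveOperator T)
    (hrad : spectralRadius ℂ T = 1) {lam : ℂ} (hlam : ‖lam‖ = 1)
    (hk : lam ^ k ∈ resolventSet ℂ T) {r s : ℝ} (hr : 1 < r) (hrs : r < s)
    {q : ℝ} (hq : q = (s - r)⁻¹ + (s - 1) * ((s - r)⁻¹ * (s - r)⁻¹))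
    (hqC : q * (C * (r - 1)) ≤ 1 / 2) (y : E) :
    ‖y‖ ≤ ((r - 1) * (2 * q * (3 * C + 1)) + 1) * ‖resolvent T (r : ℂ)‖ * ‖T y - lam • y‖ +
      2 * (r - 1) * (s - 1) ^ 2 * ‖resolvent T (r : ℂ)‖ *
        (‖resolvent T ((s : ℂ) * lam ^ k)‖ ^ 2 * ‖resolvent T (lam ^ k)‖ *
          ((‖T‖ + 1) * (2 * C + 1))) * ‖y‖ := by
  have hs : 1 < s := hr.trans hrs
  have hs0 : 0 < s := zero_lt_one.trans hs
  have hC0 : 0 < C := zero_lt_one.trans_le hC.1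
  set μ := lam ^ k with hμ
  have hμ1 : ‖μ‖ = 1 := norm_zpow_eq_one hlam k
  have hout : ∀ ν : ℂ, 1 < ‖ν‖ → spectralRadius ℂ T < ‖ν‖₊ := fun ν hν => by
    rw [hrad]
    exact_mod_cast hν
  have hnr : ‖(r : ℂ)‖ = r := by
    rw [Complex.norm_real, Real.norm_of_nonneg (by linarith)]
  have hns : ‖(s : ℂ)‖ = s := by
    rw [Complex.norm_real, Real.norm_of_nonneg hs0.le]
  have hnsμ : ‖(s : ℂ) * μ‖ = s := by rw [norm_mul, hns, hμ1, mul_one]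
  have hrρ := spectrum.mem_resolventSet_of_spectralRadius_lt (hout (r : ℂ) (by rwa [hnr]))
  have hsρ := spectrum.mem_resolventSet_of_spectralRadius_lt (hout (s : ℂ) (by rwa [hns]))
  have hsμρ := spectrum.mem_resolventSet_of_spectralRadius_lt (hout ((s : ℂ) * μ) (by rwa [hnsμ]))
  have hP : L.IsPositiveOperator (resolvent T (r : ℂ)) :=
    hT.resolvent (by linarith) (by rw [hrad]; simpa using hr)
  have hQ : L.IsPositiveOperator (resolvent T (s : ℂ)) :=
    hT.resolvent hs0 (by rw [hrad]; simpa using hs)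
  have hdom : ∀ u, L.modulus (resolvent T ((s : ℂ) * μ) u) ≤
      L.realOp (resolvent T (s : ℂ)) (L.modulus u) := fun u => by
    have := hT.modulus_resolvent_le (hout ((s : ℂ) * μ) (by rwa [hnsμ])) u
    rwa [hnsμ] at this
  set Rr := resolvent T (r : ℂ) with hRr
  set Rs := resolvent T (s : ℂ) with hRs
  set Rsμ := resolvent T ((s : ℂ) * μ) with hRsμ
  set Rμ := resolvent T μ with hRμ
  set P := L.realOp Rr with hPdef
  set Q := L.realOp Rs with hQdef
  set N := L.modulus y with hN
  set e := T y - lam • y with he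
  set v := L.signPow hC y with hv
  set w := T v - μ • v with hw
  set f := Rsμ (Rsμ (Rμ w)) with hf
  -- The resolvent at `r` inverts `r - T` on `X`.
  have hPT : ∀ x, P (L.realOp T x) = r • P x - x := by
    intro x
    have h1 : Rr * T = (r : ℂ) • Rr - 1 := by
      have h2 := resolvent_mul_sub hrρ
      rw [mul_sub, Algebra.algebraMap_eq_smul_one, mul_smul_comm, mul_one] at h2
      rw [← h2, hRr]; abel
    rw [hPdef, ← hT.realOp_mul, h1, realOp_apply, realOp_apply]
    simp [Complex.coe_smul]
  -- Products of the positive resolvents are controlled by `P`.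
  have hPQ : ∀ x, 0 ≤ x → P (Q x) ≤ (s - r)⁻¹ • P x := by
    intro x hx
    rw [le_inv_smul_iff_of_pos (by linarith)]
    have h1 := resolvent_sub_resolvent_eq_smul_mul hrρ hsρ
    rw [← hRr, ← hRs] at h1
    have h2 : P x - Q x = (s - r) • P (Q x) := by
      rw [hPdef, hQdef, ← hQ.realOp_mul, realOp_apply, realOp_apply, realOp_apply, ← map_sub,
        ← map_smul, ← Complex.coe_smul, ← sub_apply, h1]
      simp
    rw [← h2]
    exact sub_le_self _ (hQ.realOp_nonneg hx)
  -- Here `P T = r P - 1` gains the factor `r - 1`.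
  have hPw : P (L.modulus w) ≤ (C * (r - 1)) • P N + (3 * C + 1) • P (L.modulus e) := by
    have h1 := hP.realOp_mono (modulus_apply_signPow_sub_smul_le hC hT hlam y)
    have h2 : C • (P (L.realOp T N) - P N) ≤ (C * (r - 1)) • P N := by
      rw [hPT, ← sub_nonneg]
      convert smul_nonneg hC0.le (L.modulus_nonneg y) using 1
      module
    rw [map_add, map_smul, map_smul, map_sub] at h1
    exact h1.trans (add_le_add_left h2 _)
  -- Since `v = -R(μ) w`, this is the modulus of the twofold iterated resolvent equation
  -- `R(μ) = R(s μ) + (s - 1) μ R(s μ)² + (s - 1)² μ² R(s μ)² R(μ)`.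
  have hmv : L.modulus v ≤ Q (L.modulus w) + (s - 1) • Q (Q (L.modulus w)) +
      (s - 1) ^ 2 • L.modulus f := by
    have h1 : Rμ w = -v := by
      have h2 := congrArg (fun S : E →L[ℂ] E => S v) (resolvent_mul_sub hk)
      simp only [mul_apply_eq_comp, Algebra.algebraMap_eq_smul_one,
        sub_apply, smul_apply, one_apply_eq_self] at h2
      rw [hw, ← neg_sub, map_neg, h2]
    have h3 : ∀ u, Rμ u = Rsμ u + (((s - 1 : ℝ) : ℂ) * μ) • Rsμ (Rμ u) := by
      intro u
      have h4 := congrArg (fun S : E →L[ℂ] E => S u)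
        (resolvent_sub_resolvent_eq_smul_mul hsμρ hk)
      simp only [mul_apply_eq_comp, sub_apply, smul_apply] at h4
      rw [sub_eq_iff_eq_add] at h4
      rw [h4]
      push_cast
      module
    have h5 : -v = Rsμ w + (((s - 1 : ℝ) : ℂ) * μ) • Rsμ (Rsμ w) +
        (((s - 1 : ℝ) : ℂ) * μ) ^ 2 • f := by
      rw [← h1, h3 w]
      conv_lhs => rw [h3 w, map_add, map_smul]
      rw [hf]
      module
    have hn : ‖((s - 1 : ℝ) : ℂ) * μ‖ = s - 1 := by
      rw [norm_mul, hμ1, mul_one, Complex.norm_real, Real.norm_of_nonneg (by linarith)]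
    rw [← L.modulus_neg v, h5]
    refine (L.modulus_add_le _ _).trans (add_le_add ((L.modulus_add_le _ _).trans
      (add_le_add (hdom w) ?_)) ?_)
    · refine (L.modulus_smul_le _ _).trans ?_
      rw [hn]
      exact smul_le_smul_of_nonneg_left ((hdom _).trans (hQ.realOp_mono (hdom w))) (by linarith)
    · refine (L.modulus_smul_le _ _).trans ?_
      rw [norm_pow, hn]
  -- The terms containing `w` are absorbed into the left-hand side by the choice of `q`.
  have hPN : P N ≤ (2 * q * (3 * C + 1)) • P (L.modulus e) +
      (2 * (s - 1) ^ 2) • P (L.modulus f) := by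
    have hinv : 0 ≤ (s - r)⁻¹ := inv_nonneg.2 (by linarith)
    have hq0 : 0 ≤ q := by
      rw [hq]
      have : 0 ≤ s - 1 := by linarith
      positivity
    have hPN0 : 0 ≤ P N := hP.realOp_nonneg (L.modulus_nonneg y)
    have hw0 := L.modulus_nonneg w
    have h1 := hP.realOp_mono ((L.modulus_le_modulus_signPow hC y).trans hmv)
    rw [map_add, map_add, map_smul, map_smul] at h1
    have h2 := hPQ _ hw0
    have h3 : P (Q (Q (L.modulus w))) ≤ ((s - r)⁻¹ * (s - r)⁻¹) • P (L.modulus w) := by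
      rw [mul_smul]
      exact (hPQ _ (hQ.realOp_nonneg hw0)).trans (smul_le_smul_of_nonneg_left h2 hinv)
    have h4 := smul_le_smul_of_nonneg_left h3 (by linarith : 0 ≤ s - 1)
    have h5 := smul_le_smul_of_nonneg_left hPw hq0
    have h6 := smul_le_smul_of_nonneg_right hqC hPN0
    have h7 := add_le_add h1 (add_le_add (add_le_add h2 h4) (add_le_add h5 h6))
    rw [← sub_nonneg] at h7
    have h8 := smul_nonneg (zero_le_two : (0 : ℝ) ≤ 2) h7
    rw [← sub_nonneg]
    convert h8 using 1
    rw [hq]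
    module
  -- Write `|y| = P (r |y| - T|y|)` and use `|y| ≤ T|y| + |e|`.
  have hNle : N ≤ ((r - 1) * (2 * q * (3 * C + 1)) + 1) • P (L.modulus e) +
      (2 * (r - 1) * (s - 1) ^ 2) • P (L.modulus f) := by
    have h1 : N ≤ L.realOp T N + L.modulus e := by
      have h2 := L.modulus_add_le (T y) (-e)
      rw [L.modulus_neg, he, neg_sub, add_sub_cancel, L.modulus_smul_of_norm_eq_one hlam] at h2
      exact h2.trans (add_le_add_left (hT.modulus_apply_le y) _)
    have h3 := hP.realOp_mono h1
    rw [map_add, ← hPdef, hPT] at h3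
    have h4 := smul_le_smul_of_nonneg_left hPN (by linarith : 0 ≤ r - 1)
    have h5 := add_le_add h3 h4
    rw [← sub_nonneg] at h5 ⊢
    convert h5 using 1
    module
  have hq0 : 0 ≤ q := by
    rw [hq]
    have : 0 ≤ s - 1 := by linarith
    have : 0 ≤ (s - r)⁻¹ := inv_nonneg.2 (by linarith)
    positivity
  have hr0 : 0 ≤ r - 1 := by linarith
  have h1 := norm_le_norm_of_nonneg_of_le (L.modulus_nonneg y) hNle
  rw [L.norm_modulus] at h1
  have hPe : ‖P (L.modulus e)‖ ≤ ‖Rr‖ * ‖e‖ := by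
    simpa [L.norm_modulus] using L.norm_realOp_le Rr (L.modulus_nonneg e)
  have hPf : ‖P (L.modulus f)‖ ≤ ‖Rr‖ * ‖f‖ := by
    simpa [L.norm_modulus] using L.norm_realOp_le Rr (L.modulus_nonneg f)
  have hvn : ‖v‖ ≤ (2 * C + 1) * ‖y‖ := by
    have := norm_le_norm_of_nonneg_of_le (L.modulus_nonneg v) (L.modulus_signPow_le hC y)
    rwa [norm_smul, L.norm_modulus, L.norm_modulus, Real.norm_of_nonneg (by linarith)] at this
  have hwn : ‖w‖ ≤ (‖T‖ + 1) * (2 * C + 1) * ‖y‖ := by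
    have h2 : ‖w‖ ≤ (‖T‖ + 1) * ‖v‖ := by
      refine (norm_sub_le _ _).trans ?_
      rw [norm_smul, hμ1, add_mul]
      exact add_le_add_left (T.le_opNorm v) _
    refine h2.trans ?_
    rw [mul_assoc]
    exact mul_le_mul_of_nonneg_left hvn (by positivity)
  have hfn : ‖f‖ ≤ ‖Rsμ‖ ^ 2 * ‖Rμ‖ * ‖w‖ := by
    calc ‖f‖ ≤ ‖Rsμ‖ * (‖Rsμ‖ * (‖Rμ‖ * ‖w‖)) :=
          Rsμ.le_opNorm_of_le (Rsμ.le_opNorm_of_le (Rμ.le_opNorm w))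
      _ = _ := by ring
  have hfn' : ‖f‖ ≤ ‖Rsμ‖ ^ 2 * ‖Rμ‖ * ((‖T‖ + 1) * (2 * C + 1)) * ‖y‖ := by
    refine hfn.trans ?_
    rw [mul_assoc _ _ ‖y‖]
    exact mul_le_mul_of_nonneg_left hwn (by positivity)
  refine h1.trans ((norm_add_le _ _).trans (add_le_add ?_ ?_))
  · rw [norm_smul, Real.norm_of_nonneg (by positivity), mul_assoc _ ‖Rr‖]
    exact mul_le_mul_of_nonneg_left hPe (by positivity)
  · rw [norm_smul, Real.norm_of_nonneg (by positivity), mul_assoc _ _ ‖y‖, mul_assoc _ ‖Rr‖]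
    refine mul_le_mul_of_nonneg_left (hPf.trans ?_) (by positivity)
    exact mul_le_mul_of_nonneg_left hfn' (norm_nonneg _)

end ComplexBanachLattice

/-! ### The powers of a peripheral spectral value -/

theorem theorem4p1 {X E : Type*}
    [NormedAddCommGroup X] [NormedSpace ℝ X] [CompleteSpace X]
    [Lattice X] [IsOrderedAddMonoid X] [IsOrderedModule ℝ X] [HasSolidNorm X]
    [NormedAddCommGroup E] [NormedSpace ℂ E] [CompleteSpace E]
    (L : ComplexBanachLattice X E)
    (T : E →L[ℂ] E) (hT : L.IsPositiveOperator T) (hrad : spectralRadius ℂ T = 1)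
    (lam : ℂ) (hlam : lam ∈ peripheralSpectrum T)
    (hseq : ∃ r : ℕ → ℝ, (∀ n, 1 < r n) ∧ Antitone r ∧ Tendsto r atTop (𝓝 1) ∧
      (fun n => ‖resolvent T ((r n : ℂ) * lam)‖) =Θ[atTop] (fun n => 1 / (r n - 1)) ∧
      (fun n => ‖resolvent T (r n : ℂ)‖) =O[atTop] (fun n => 1 / (r n - 1) ^ 2)) :
    ∀ k : ℤ, lam ^ k ∈ peripheralSpectrum T := by
  intro k
  obtain ⟨r, hr1, -, hr, hΘ, hO⟩ := hseq
  have hlam1 : ‖lam‖ = 1 := by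
    have := hlam.2
    rw [hrad, ENNReal.coe_eq_one] at this
    rw [← coe_nnnorm, this, NNReal.coe_one]
  have hμ1 : ‖lam ^ k‖ = 1 := by rw [norm_zpow, hlam1, one_zpow]
  refine ⟨?_, by rw [hrad, ENNReal.coe_eq_one]; exact NNReal.eq hμ1⟩
  by_contra hcon
  have hk : lam ^ k ∈ resolventSet ℂ T := not_not.1 hcon
  obtain ⟨C, hC⟩ := ComplexBanachLattice.exists_isTaylorBound k
  have hC1 := hC.1
  -- The factor `6 * C + 1` is large enough for the absorption: it gives
  -- `q * C * (r - 1) = (12 * C + 1) / (36 * C) ≤ 1 / 2`.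
  let s : ℕ → ℝ := fun n => 1 + (6 * C + 1) * (r n - 1)
  have hr0 : Tendsto (fun n => r n - 1) atTop (𝓝 0) := by simpa using hr.sub_const 1
  have hs : Tendsto s atTop (𝓝 1) := by
    simpa using (hr0.const_mul (6 * C + 1)).const_add 1
  have hsμ : Tendsto (fun n => (s n : ℂ) * lam ^ k) atTop (𝓝 (lam ^ k)) := by
    have := ((Complex.continuous_ofReal.tendsto 1).comp hs).mul_const (lam ^ k)
    simpa using this
  have hbdd : ∀ᶠ n in atTop,
      ‖resolvent T ((s n : ℂ) * lam ^ k)‖ ≤ ‖resolvent T (lam ^ k)‖ + 1 := by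
    have := ((continuousAt_resolvent hk).tendsto.comp hsμ).norm
    exact (this.eventually_lt_const (lt_add_one _)).mono fun n hn => hn.le
  obtain ⟨M, hM0, hM⟩ := hO.exists_pos
  rw [isBigOWith_iff] at hM
  let D : ℝ := 2 * (6 * C + 1) ^ 2 * M * ((‖resolvent T (lam ^ k)‖ + 1) ^ 2 *
    ‖resolvent T (lam ^ k)‖ * ((‖T‖ + 1) * (2 * C + 1)))
  have hsmall : ∀ᶠ n in atTop, D * (r n - 1) ≤ 1 / 2 := by
    have : Tendsto (fun n => D * (r n - 1)) atTop (𝓝 0) := by simpa using hr0.const_mul D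
    exact (this.eventually_lt_const one_half_pos).mono fun n hn => hn.le
  obtain ⟨n, hn1, hn2, hn3⟩ := (hbdd.and (hM.and hsmall)).exists
  have hp : 0 < r n - 1 := sub_pos.2 (hr1 n)
  have hsr : s n - r n = 6 * C * (r n - 1) := by simp only [s]; ring
  have hs1 : s n - 1 = (6 * C + 1) * (r n - 1) := by simp only [s]; ring
  have hrs : r n < s n := by
    rw [← sub_pos, hsr]
    positivity
  set q := (s n - r n)⁻¹ + (s n - 1) * ((s n - r n)⁻¹ * (s n - r n)⁻¹) with hq
  have hqC : q * (C * (r n - 1)) ≤ 1 / 2 := by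
    have e : q * (C * (r n - 1)) = (12 * C + 1) / (36 * C) := by
      rw [hq, hsr, hs1]
      field_simp
      ring
    rw [e, div_le_iff₀ (by positivity)]
    linarith
  have key := ComplexBanachLattice.norm_le_of_approx_eigenvector (L := L) hC hT hrad hlam1 hk
    (hr1 n) hrs hq hqC
  -- With `n` fixed, the defect of `y` can be made small compared with the constant `Z`.
  set Z := ((r n - 1) * (2 * q * (3 * C + 1)) + 1) * ‖resolvent T (r n : ℂ)‖ with hZ
  obtain ⟨y, hy0, hy⟩ : ∃ y : E, y ≠ 0 ∧ ‖T y - lam • y‖ ≤ (1 / (4 * (|Z| + 1))) * ‖y‖ := by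
    have hres : ∀ n, (r n : ℂ) * lam ∈ resolventSet ℂ T := fun n => by
      refine spectrum.mem_resolventSet_of_spectralRadius_lt ?_
      have : 1 < ‖(r n : ℂ) * lam‖ := by
        rw [norm_mul, hlam1, mul_one, Complex.norm_real]
        exact (hr1 n).trans_le (le_abs_self _)
      rw [hrad]
      exact_mod_cast this
    have hlim : Tendsto (fun n => (r n : ℂ) * lam) atTop (𝓝 lam) := by
      have := ((Complex.continuous_ofReal.tendsto 1).comp hr).mul_const lam
      simpa using this
    have hinf : Tendsto (fun n => ‖resolvent T ((r n : ℂ) * lam)‖) atTop atTop := by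
      have h1 : Tendsto (fun n => 1 / (r n - 1)) atTop atTop := by
        simp only [one_div]
        exact tendsto_inv_nhdsGT_zero.comp (tendsto_nhdsWithin_iff.2
          ⟨hr0, Eventually.of_forall fun n => sub_pos.2 (hr1 n)⟩)
      obtain ⟨c, hc0, hc⟩ := hΘ.2.exists_pos
      rw [isBigOWith_iff] at hc
      refine tendsto_atTop_mono' _ (hc.mono fun n hn => ?_) (h1.const_mul_atTop (inv_pos.2 hc0))
      rw [norm_norm] at hn
      rw [inv_mul_le_iff₀ hc0]
      exact (le_abs_self _).trans hn
    exact exists_norm_apply_sub_smul_le hlim hres hinf (by positivity)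
  have hypos : 0 < ‖y‖ := norm_pos_iff.2 hy0
  have h1 : Z * ‖T y - lam • y‖ ≤ 1 / 4 * ‖y‖ := by
    calc Z * ‖T y - lam • y‖ ≤ (|Z| + 1) * ((1 / (4 * (|Z| + 1))) * ‖y‖) := by
          refine mul_le_mul ?_ hy (norm_nonneg _) (by positivity)
          linarith [le_abs_self Z]
      _ = 1 / 4 * ‖y‖ := by
          have : |Z| + 1 ≠ 0 := by positivity
          field_simp
  have h2 : 2 * (r n - 1) * (s n - 1) ^ 2 * ‖resolvent T (r n : ℂ)‖ *
      (‖resolvent T ((s n : ℂ) * lam ^ k)‖ ^ 2 * ‖resolvent T (lam ^ k)‖ *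
        ((‖T‖ + 1) * (2 * C + 1))) ≤ D * (r n - 1) := by
    rw [norm_norm, Real.norm_of_nonneg (by positivity)] at hn2
    have e : D * (r n - 1) = 2 * (r n - 1) * ((6 * C + 1) * (r n - 1)) ^ 2 *
        (M * (1 / (r n - 1) ^ 2)) * ((‖resolvent T (lam ^ k)‖ + 1) ^ 2 *
          ‖resolvent T (lam ^ k)‖ * ((‖T‖ + 1) * (2 * C + 1))) := by
      simp only [D]
      field_simp
    rw [e, hs1]
    gcongr
  have h3 := mul_le_mul_of_nonneg_right (h2.trans hn3) hypos.le
  linarith [key y]
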